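/- Let $(\Omega,\mathcal F,\mathbb P)$ be a probability space with a right-continuous filtration $(\mathcal F_t)_{t\ge 0}$, let $\mathcal X\subseteq\mathbb R^n$ be open and connected, and let $X=(X_t)_{t\ge 0}$ be an adapted $\mathcal X$-valued process with continuous paths. For $0\le s<T<\infty$ let $C([s,T];\mathcal X)$ be the space of continuous maps $[s,T]\to\mathcal X$ with the uniform metric and its Borel $\sigma$-algebra. Assume that $X$ has conditional full support: for all deterministic times $0\le s<T<\infty$, the support of the regular conditional distribution of the path $X|_{[s,T]}$ given $\mathcal F_s$, a random probability measure on $C([s,T];\mathcal X)$, is almost surely equal to $\{x\in C([s,T];\mathcal X) : x(s)=X_s\}$. Let $f:\mathcal X\to[0,\infty)$ be continuous with $0\in f(\mathcal X)$. Then the process \[ U_t=\int_0^t f(X_s)\,ds,\qquad t\ge 0, \] is sticky. That is, for every $T\in[0,\infty)$, every stopping time $\tau$ with values in $[0,\infty]$, and every almost surely strictly positive $\mathcal F_\tau$-measurable random variable $\varepsilon$, the stopped process $U^T_t=U_{t\wedge T}$ satisfies \[ \mathbb P\Big(\sup_{t\in[\tau,\infty)}\big|U^T_t-U^T_\tau\big|\le\varepsilon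 \,\Big|\, \mathcal F_\tau\Big)>0\quad\text{almost surely,} \] where the supremum over the empty set (on $\{\tau=\infty\}$) is $-\infty$. -/

import Mathlib

open MeasureTheory ProbabilityTheory
open scoped NNReal

section Sticky

/-- A process `X` is globally sticky if `ℙ(sup_{t ≥ τ} d(X_t, X_τ) ≤ ε | ℱ_τ) > 0` almost surely,
for every stopping time `τ` (possibly infinite) and every strictly positive `ℱ_τ`-measurable
random variable `ε`. On `{τ = ∞}` the supremum is over the empty set, and the bound holds. -/
def IsGloballySticky {Ω E : Type*} [PseudoMetricSpace E] {mΩ : MeasurableSpace Ω} (ℱ : Filtration ℝ≥0 mΩ)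
    (X : ℝ≥0 → Ω → E) (μ : Measure Ω) : Prop :=
  ∀ (τ : Ω → WithTop ℝ≥0) (hτ : IsStoppingTime ℱ τ) (ε : Ω → ℝ),
    Measurable[hτ.measurableSpace] ε → (∀ᵐ ω ∂μ, 0 < ε ω) →
      ∀ᵐ ω ∂μ, 0 < (μ⟦{ω' | ∀ t : ℝ≥0, τ ω' ≤ (t : WithTop ℝ≥0) →
        dist (X t ω') (stoppedValue X τ ω') ≤ ε ω'} | hτ.measurableSpace⟧) ω

/-- A process `X` is sticky if, for every deterministic time `T`, the stopped process
`(X_{t ∧ T})_{t ≥ 0}` is globally sticky. -/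
def IsSticky {Ω E : Type*} [PseudoMetricSpace E] {mΩ : MeasurableSpace Ω} (ℱ : Filtration ℝ≥0 mΩ)
    (X : ℝ≥0 → Ω → E) (μ : Measure Ω) : Prop :=
  ∀ T : ℝ≥0, IsGloballySticky ℱ (fun t ω => X (min t T) ω) μ

end Sticky

section ConditionalFullSupport

/-- The Borel σ-algebra on a space of continuous maps; on a compact domain the topology is that of
the uniform metric. -/
instance continuousMapMeasurableSpace {α β : Type*} [TopologicalSpace α] [TopologicalSpace β] :
    MeasurableSpace C(α, β) := borel _

instance continuousMapBorelSpace {α β : Type*} [TopologicalSpace α] [TopologicalSpace β] :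
    BorelSpace C(α, β) := ⟨rfl⟩

/-- The Markov kernel `κ` from `(Ω, m)` to `F` is a regular conditional distribution
of the random element `Y` of `F` given the σ-algebra `m`. -/
structure IsRegularCondDistrib {Ω F : Type*} [MeasurableSpace F] (m : MeasurableSpace Ω)
    {mΩ : MeasurableSpace Ω} (Y : Ω → F) (μ : Measure Ω) (κ : @Kernel Ω F m _) : Prop where
  isMarkovKernel : IsMarkovKernel κ
  condProb_eq : ∀ A : Set F, MeasurableSet A →
    (fun ω => (κ ω).real A) =ᵐ[μ] μ⟦Y ⁻¹' A | m⟧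

/-- The restriction of the path `t ↦ X_t(ω)` to `[s, T]`, as an element of `C([s, T]; E)`. -/
def pathOn {Ω E : Type*} [TopologicalSpace E] (X : ℝ≥0 → Ω → E)
    (hX : ∀ ω, Continuous fun t => X t ω) (s T : ℝ≥0) (ω : Ω) : C(Set.Icc s T, E) :=
  ⟨fun t => X t ω, (hX ω).comp continuous_subtype_val⟩

/-- Conditional full support of a process with continuous paths: for all deterministic times
`0 ≤ s < T`, the support of the regular conditional distribution of `X|_[s, T]` given `ℱ_s` is
almost surely the set of all continuous paths on `[s, T]` that start from `X_s` at time `s`. -/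
def HasConditionalFullSupport {Ω E : Type*} [TopologicalSpace E] {mΩ : MeasurableSpace Ω}
    (ℱ : Filtration ℝ≥0 mΩ)
    (X : ℝ≥0 → Ω → E) (hX : ∀ ω, Continuous fun t => X t ω) (μ : Measure Ω) : Prop :=
  ∀ (s T : ℝ≥0) (hsT : s < T), ∃ κ : @Kernel Ω C(Set.Icc s T, E) (ℱ s) _,
    IsRegularCondDistrib (ℱ s) (pathOn X hX s T) μ κ ∧
      ∀ᵐ ω ∂μ, (κ ω).support =
        {x : C(Set.Icc s T, E) | x ⟨s, Set.left_mem_Icc.mpr hsT.le⟩ = X s ω}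

end ConditionalFullSupport

/-!
A continuous adapted process that is sticky at deterministic times is sticky. Otherwise the process
leaves its `ε`-neighbourhood after `τ` almost surely on some `A ∈ ℱ_τ` of positive probability. This
is impossible where `τ ≥ T`. The rest of `A` is covered by countably many events on which, for some
deterministic `q > τ`, the path stays close to `X_q` during `[τ, q]`. Each of them lies in `ℱ_q`, so
stickiness at the deterministic time `q` makes it null.

For an integral `U_t = ∫₀ᵗ f(X_u) du`, stickiness at a deterministic time `s` follows from
conditional full support: `∫ₛᵀ ‖f(x(u))‖ du < η` defines an open set of paths `x`, and it contains a
path from any starting point, namely one that runs quickly to a zero of `f` and stays there.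
-/

section ConditionalProbability

variable {Ω : Type*} {m mΩ : MeasurableSpace Ω} {μ : Measure Ω} [IsFiniteMeasure μ]

lemma ae_condProb_pos_iff (hm : m ≤ mΩ) {E : Set Ω} (hE : MeasurableSet E) :
    (∀ᵐ ω ∂μ, 0 < (μ⟦E | m⟧) ω) ↔ ∀ A, MeasurableSet[m] A → μ (A ∩ E) = 0 → μ A = 0 := by
  have setIntegral_condProb : ∀ A, MeasurableSet[m] A →
      ∫ ω in A, (μ⟦E | m⟧) ω ∂μ = μ.real (A ∩ E) := fun A hA => by
    rw [setIntegral_condExp hm ((integrable_const (1 : ℝ)).indicator hE) hA,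
      setIntegral_indicator hE, setIntegral_one_eq_measureReal]
  constructor
  · intro hpos A hA hAE
    by_contra hA0
    have hint : 0 < ∫ ω in A, (μ⟦E | m⟧) ω ∂μ := by
      refine (setIntegral_pos_iff_support_of_nonneg_ae
        (ae_restrict_of_ae (hpos.mono fun ω hω => hω.le)) integrable_condExp.integrableOn).mpr ?_
      refine (pos_iff_ne_zero.mpr hA0).trans_le (measure_mono_ae ?_)
      filter_upwards [hpos] with ω hω hωA using ⟨hω.ne', hωA⟩
    rw [setIntegral_condProb A hA, measureReal_def, hAE] at hint
    exact lt_irrefl _ hint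
  · intro h
    have hA : MeasurableSet[m] {ω | (μ⟦E | m⟧) ω ≤ 0} :=
      measurableSet_le stronglyMeasurable_condExp.measurable measurable_const
    have hAE : μ.real ({ω | (μ⟦E | m⟧) ω ≤ 0} ∩ E) ≤ 0 := by
      rw [← setIntegral_condProb _ hA]
      exact setIntegral_nonpos (hm _ hA) fun ω hω => hω
    simpa only [ae_iff, not_lt] using
      h _ hA ((measureReal_eq_zero_iff).mp (hAE.antisymm measureReal_nonneg))

lemma ae_condProb_pos_mono {E E' : Set Ω} (hE : MeasurableSet E) (hE' : MeasurableSet E')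
    (hEE' : E ⊆ E') (hpos : ∀ᵐ ω ∂μ, 0 < (μ⟦E | m⟧) ω) : ∀ᵐ ω ∂μ, 0 < (μ⟦E' | m⟧) ω := by
  have hle : μ⟦E | m⟧ ≤ᵐ[μ] μ⟦E' | m⟧ :=
    condExp_mono ((integrable_const (1 : ℝ)).indicator hE)
      ((integrable_const (1 : ℝ)).indicator hE')
      (ae_of_all _ (Set.indicator_le_indicator_of_subset hEE' fun _ => zero_le_one))
  filter_upwards [hpos, hle] with ω hω hωle using hω.trans_le hωle

end ConditionalProbability

section ContinuousPaths

lemma measurableSet_forall_le_of_continuous {Ω : Type*} {m : MeasurableSpace Ω}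
    {σ : Ω → WithTop ℝ≥0} (hσ : Measurable σ) {g : ℝ≥0 → Ω → ℝ}
    (hg_cont : ∀ ω, Continuous fun t => g t ω) (hg : ∀ t, Measurable (g t))
    {c : Ω → ℝ} (hc : Measurable c) :
    MeasurableSet {ω | ∀ t : ℝ≥0, σ ω ≤ t → g t ω ≤ c ω} := by
  obtain ⟨D, hD_countable, hD_dense⟩ := TopologicalSpace.exists_countable_dense ℝ≥0
  have hset : {ω | ∀ t : ℝ≥0, σ ω ≤ t → g t ω ≤ c ω} =
      ⋂ t ∈ D, {ω | t ≤ σ ω} ∪ {ω | g t ω ≤ c ω} := by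
    ext ω
    simp only [Set.mem_iInter, Set.mem_union, Set.mem_ofPred_eq]
    refine ⟨fun h t _ => (le_total (t : WithTop ℝ≥0) (σ ω)).imp_right (h t), fun h t ht => ?_⟩
    obtain ⟨r, hr⟩ := WithTop.ne_top_iff_exists.mp (ne_top_of_le_ne_top WithTop.coe_ne_top ht)
    have hclosed : IsClosed {u | g u ω ≤ c ω} := isClosed_le (hg_cont ω) continuous_const
    have hsub : Set.Ioi r ∩ D ⊆ {u | g u ω ≤ c ω} := fun u ⟨hru, huD⟩ =>
      (h u huD).resolve_left (by rw [← hr]; exact not_le.mpr (WithTop.coe_lt_coe.mpr hru))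
    have hIoi : Set.Ioi r ⊆ {u | g u ω ≤ c ω} :=
      (hD_dense.open_subset_closure_inter isOpen_Ioi).trans (closure_minimal hsub hclosed)
    have hIci : Set.Ici r ⊆ {u | g u ω ≤ c ω} := by
      rw [← closure_Ioi r]
      exact closure_minimal hIoi hclosed
    exact hIci (WithTop.coe_le_coe.mp (hr ▸ ht))
  rw [hset]
  exact .biInter hD_countable fun t _ =>
    (measurableSet_le measurable_const hσ).union (measurableSet_le (hg t) hc)

lemma exists_mem_dense_forall_dist_le {ι E : Type*} [LinearOrder ι] [DenselyOrdered ι]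
    [TopologicalSpace ι] [OrderTopology ι] [PseudoMetricSpace E] {D : Set ι} (hD : Dense D)
    {x : ι → E} {r T : ι} (hx : ContinuousWithinAt x (Set.Ici r) r) (hrT : r < T)
    {η : ℝ} (hη : 0 < η) :
    ∃ q ∈ D, r < q ∧ q < T ∧ ∀ t ∈ Set.Icc r q, dist (x t) (x q) ≤ η := by
  obtain ⟨b, ⟨hrb, hbT⟩, hb⟩ := (mem_nhdsGE_iff_exists_mem_Ioc_Ico_subset hrT).mp
    (hx (Metric.ball_mem_nhds (x r) (half_pos hη)))
  obtain ⟨q, hqD, hrq, hqb⟩ := hD.exists_between hrb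
  refine ⟨q, hqD, hrq, hqb.trans_le hbT, fun t ht => ?_⟩
  have ht_ball : dist (x t) (x r) < η / 2 := hb ⟨ht.1, ht.2.trans_lt hqb⟩
  have hq_ball : dist (x q) (x r) < η / 2 := hb ⟨hrq.le, hqb⟩
  linarith [dist_triangle_right (x t) (x q) (x r)]

end ContinuousPaths

section DeterministicTimes

variable {Ω E : Type*} [PseudoMetricSpace E] {mΩ : MeasurableSpace Ω} {μ : Measure Ω}
  {ℱ : Filtration ℝ≥0 mΩ} {X : ℝ≥0 → Ω → E} {τ : Ω → WithTop ℝ≥0} {A : Set Ω} {ω : Ω}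
  {q T : ℝ≥0} {η : ℝ}

/-- Stickiness tested only at deterministic times `s` and with deterministic radii `η`:
conditionally on `ℱ_s`, the process stays within `η` of `X_s` during `[s, T]` with positive
probability. -/
def IsStickyAtDeterministicTimes (ℱ : Filtration ℝ≥0 mΩ) (X : ℝ≥0 → Ω → E) (μ : Measure Ω) :
    Prop :=
  ∀ s T : ℝ≥0, s < T → ∀ η : ℝ, 0 < η →
    ∀ᵐ ω ∂μ, 0 < (μ⟦{ω' | ∀ t, s ≤ t → dist (X (min t T) ω') (X s ω') ≤ η} | ℱ s⟧) ω

/-- The event that `τ ≤ q` and that `X` stays within `η` of `X_q` during `[τ, q]`. It reduces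
stickiness at the stopping time `τ` to stickiness at the deterministic time `q`. -/
def settledEvent (X : ℝ≥0 → Ω → E) (τ : Ω → WithTop ℝ≥0) (q : ℝ≥0) (η : ℝ) : Set Ω :=
  {ω | τ ω ≤ q ∧ ∀ t : ℝ≥0, τ ω ≤ t → dist (X (min t q) ω) (X q ω) ≤ η}

lemma measurableSet_forall_dist_le {_ : MeasurableSpace Ω}
    (hX_cont : ∀ ω, Continuous fun t => X t ω) (hX : ∀ t ≤ T, StronglyMeasurable (X t))
    {σ : Ω → WithTop ℝ≥0} (hσ : Measurable σ)
    {Y : Ω → E} (hY : StronglyMeasurable Y) {ε : Ω → ℝ} (hε : Measurable ε) :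
    MeasurableSet {ω | ∀ t : ℝ≥0, σ ω ≤ t → dist (X (min t T) ω) (Y ω) ≤ ε ω} :=
  measurableSet_forall_le_of_continuous hσ
    (fun ω => ((hX_cont ω).comp (continuous_id.min continuous_const)).dist continuous_const)
    (fun _ => ((hX _ (min_le_right _ _)).dist hY).measurable) hε

lemma measurableSet_inter_settledEvent (hX : StronglyAdapted ℱ X)
    (hX_cont : ∀ ω, Continuous fun t => X t ω) (hτ : IsStoppingTime ℱ τ)
    (hA : MeasurableSet[hτ.measurableSpace] A) (q : ℝ≥0) (η : ℝ) :
    MeasurableSet[ℱ q] (A ∩ settledEvent X τ q η) := by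
  have hset : A ∩ settledEvent X τ q η = (A ∩ {ω | τ ω ≤ q}) ∩
      {ω | ∀ t : ℝ≥0, min (τ ω) q ≤ t → dist (X (min t q) ω) (X q ω) ≤ η} := by
    rw [settledEvent, Set.ofPred_and, ← Set.inter_assoc]
    ext ω
    refine and_congr_right fun hω => ?_
    simp only [Set.mem_ofPred_eq, min_eq_left (show τ ω ≤ q from hω.2)]
  rw [hset]
  exact (hA.2 q).inter (measurableSet_forall_dist_le hX_cont
    (fun _ ht => hX.stronglyMeasurable_le ht)
    ((hτ.min_const q).measurable_of_le fun _ => min_le_right _ _) (hX q) measurable_const)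

lemma exists_mem_settledEvent {D : Set ℝ≥0} (hD : Dense D) (hX_cont : Continuous fun t => X t ω)
    (hτT : τ ω < T) (hη : 0 < η) : ∃ q ∈ D, q < T ∧ ω ∈ settledEvent X τ q η := by
  obtain ⟨r, hr⟩ := WithTop.ne_top_iff_exists.mp hτT.ne_top
  rw [← hr, WithTop.coe_lt_coe] at hτT
  obtain ⟨q, hqD, hrq, hqT, hq⟩ :=
    exists_mem_dense_forall_dist_le hD hX_cont.continuousWithinAt hτT hη
  refine ⟨q, hqD, hqT, ?_, fun t ht => hq _ ⟨le_min ?_ hrq.le, min_le_right _ _⟩⟩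
  · rw [← hr]
    exact WithTop.coe_le_coe.mpr hrq.le
  · rwa [← hr, WithTop.coe_le_coe] at ht

lemma dist_stoppedValue_le_of_mem_settledEvent (hω : ω ∈ settledEvent X τ q η) (hqT : q ≤ T)
    (hqω : ∀ t, q ≤ t → dist (X (min t T) ω) (X q ω) ≤ η) {t : ℝ≥0} (ht : τ ω ≤ t) :
    dist (X (min t T) ω) (stoppedValue (fun t ω => X (min t T) ω) τ ω) ≤ 2 * η := by
  obtain ⟨hτq, hτω⟩ := hω
  obtain ⟨r, hr⟩ := WithTop.ne_top_iff_exists.mp (ne_top_of_le_ne_top WithTop.coe_ne_top hτq)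
  have hrq : r ≤ q := WithTop.coe_le_coe.mp (hr ▸ hτq)
  have hτ_dist : dist (X r ω) (X q ω) ≤ η := by
    simpa only [min_eq_left hrq] using hτω r hr.ge
  have ht_dist : dist (X (min t T) ω) (X q ω) ≤ η := by
    rcases le_total q t with hqt | htq
    · exact hqω t hqt
    · simpa only [min_eq_left htq, min_eq_left (htq.trans hqT)] using hτω t ht
  simp only [stoppedValue, ← hr, WithTop.untopD_coe, min_eq_left (hrq.trans hqT)]
  linarith [dist_triangle_right (X (min t T) ω) (X r ω) (X q ω)]

lemma dist_stoppedValue_eq_zero_of_le (hTτ : T ≤ τ ω) {t : ℝ≥0} (ht : τ ω ≤ t) :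
    dist (X (min t T) ω) (stoppedValue (fun t ω => X (min t T) ω) τ ω) = 0 := by
  obtain ⟨r, hr⟩ := WithTop.ne_top_iff_exists.mp (ne_top_of_le_ne_top WithTop.coe_ne_top ht)
  rw [← hr, WithTop.coe_le_coe] at hTτ ht
  simp only [stoppedValue, ← hr, WithTop.untopD_coe, min_eq_right hTτ, min_eq_right (hTτ.trans ht),
    dist_self]

lemma stronglyMeasurable_stoppedValue_of_continuous (hX_cont : ∀ ω, Continuous fun t => X t ω)
    (hX : ∀ t, StronglyMeasurable (X t)) (hτ : Measurable τ) :
    StronglyMeasurable (stoppedValue X τ) :=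
  (stronglyMeasurable_uncurry_of_continuous_of_stronglyMeasurable hX_cont hX).comp_measurable
    (hτ.untopA.prodMk measurable_id)

variable [IsFiniteMeasure μ]

lemma IsStickyAtDeterministicTimes.measure_inter_settledEvent_eq_zero
    (h : IsStickyAtDeterministicTimes ℱ X μ) (hX : StronglyAdapted ℱ X)
    (hX_cont : ∀ ω, Continuous fun t => X t ω) (hτ : IsStoppingTime ℱ τ)
    (hA : MeasurableSet[hτ.measurableSpace] A) (hqT : q < T) (hη : 0 < η)
    (hnull : μ {ω ∈ A | ∀ t : ℝ≥0, τ ω ≤ t →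
      dist (X (min t T) ω) (stoppedValue (fun t ω => X (min t T) ω) τ ω) ≤ 2 * η} = 0) :
    μ (A ∩ settledEvent X τ q η) = 0 := by
  have hquiet : MeasurableSet {ω | ∀ t, q ≤ t → dist (X (min t T) ω) (X q ω) ≤ η} := by
    simpa only [WithTop.coe_le_coe] using
      measurableSet_forall_dist_le (σ := fun _ => (q : WithTop ℝ≥0)) (ε := fun _ => η) hX_cont
        (fun _ _ => hX.stronglyMeasurable) measurable_const hX.stronglyMeasurable measurable_const
  refine (ae_condProb_pos_iff (ℱ.le q) hquiet).mp (h q T hqT η hη) _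
    (measurableSet_inter_settledEvent hX hX_cont hτ hA q η) (measure_mono_null ?_ hnull)
  rintro ω ⟨⟨hωA, hωq⟩, hωquiet⟩
  exact ⟨hωA, fun t ht => dist_stoppedValue_le_of_mem_settledEvent hωq hqT.le hωquiet ht⟩

theorem IsStickyAtDeterministicTimes.isSticky (h : IsStickyAtDeterministicTimes ℱ X μ)
    (hX : StronglyAdapted ℱ X) (hX_cont : ∀ ω, Continuous fun t => X t ω) : IsSticky ℱ X μ := by
  intro T τ hτ ε hε hε_pos
  have hevent : MeasurableSet {ω | ∀ t : ℝ≥0, τ ω ≤ t →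
      dist (X (min t T) ω) (stoppedValue (fun t ω => X (min t T) ω) τ ω) ≤ ε ω} :=
    measurableSet_forall_dist_le hX_cont (fun _ _ => hX.stronglyMeasurable) hτ.measurable'
      (stronglyMeasurable_stoppedValue_of_continuous
        (fun ω => (hX_cont ω).comp (continuous_id.min continuous_const))
        (fun _ => hX.stronglyMeasurable) hτ.measurable') (hε.mono hτ.measurableSpace_le le_rfl)
  refine (ae_condProb_pos_iff hτ.measurableSpace_le hevent).mpr fun A hA hA_leaves => ?_
  obtain ⟨D, hD_countable, hD_dense⟩ := TopologicalSpace.exists_countable_dense ℝ≥0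
  have hsettled : ∀ q ∈ D, ∀ n : ℕ, q < T →
      μ (A ∩ {ω | 2 * (1 / ((n : ℝ) + 1)) < ε ω} ∩ settledEvent X τ q (1 / (n + 1))) = 0 :=
    fun q _ n hqT => by
      refine h.measure_inter_settledEvent_eq_zero hX hX_cont hτ (hA.inter (hε measurableSet_Ioi))
        hqT Nat.one_div_pos_of_nat (measure_mono_null ?_ hA_leaves)
      rintro ω ⟨⟨hωA, hωn⟩, hω⟩
      exact ⟨hωA, fun t ht => (hω t ht).trans (le_of_lt hωn)⟩
  have hsettled_ae : ∀ᵐ ω ∂μ, ∀ q ∈ D, ∀ n : ℕ, q < T →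
      ω ∉ A ∩ {ω | 2 * (1 / ((n : ℝ) + 1)) < ε ω} ∩ settledEvent X τ q (1 / (n + 1)) := by
    simpa only [ae_ball_iff hD_countable, ae_all_iff, ← measure_eq_zero_iff_ae_notMem]
      using hsettled
  rw [measure_eq_zero_iff_ae_notMem] at hA_leaves ⊢
  filter_upwards [hA_leaves, hsettled_ae, hε_pos] with ω hω_leaves hω_settled hεω hωA
  rcases le_or_gt (T : WithTop ℝ≥0) (τ ω) with hTτ | hτT
  · exact hω_leaves ⟨hωA, fun t ht => (dist_stoppedValue_eq_zero_of_le hTτ ht).trans_le hεω.le⟩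
  · obtain ⟨n, hn⟩ := exists_nat_one_div_lt (half_pos hεω)
    obtain ⟨q, hqD, hqT, hq⟩ :=
      exists_mem_settledEvent hD_dense (hX_cont ω) hτT (Nat.one_div_pos_of_nat (n := n))
    exact hω_settled q hqD n hqT ⟨⟨hωA, (lt_div_iff₀' two_pos).mp hn⟩, hq⟩

end DeterministicTimes

section TimeIntegral

variable {F : Type*} [NormedAddCommGroup F]

lemma intervalIntegrable_comp_toNNReal {h : ℝ≥0 → F} (hh : Continuous h) (a b : ℝ) :
    IntervalIntegrable (fun u : ℝ => h u.toNNReal) volume a b :=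
  (hh.comp continuous_real_toNNReal).intervalIntegrable a b

variable [NormedSpace ℝ F]

lemma continuous_integral_comp_toNNReal {h : ℝ≥0 → F} (hh : Continuous h) :
    Continuous fun t : ℝ≥0 => ∫ u in (0 : ℝ)..t, h u.toNNReal :=
  (intervalIntegral.continuous_primitive (intervalIntegrable_comp_toNNReal hh) 0).comp
    NNReal.continuous_coe

lemma dist_integral_comp_toNNReal_le {h : ℝ≥0 → F} (hh : Continuous h) {s t T : ℝ≥0} (hst : s ≤ t)
    (htT : t ≤ T) :
    dist (∫ u in (0 : ℝ)..t, h u.toNNReal) (∫ u in (0 : ℝ)..s, h u.toNNReal) ≤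
      ∫ u in (s : ℝ)..T, ‖h u.toNNReal‖ := by
  rw [dist_eq_norm, intervalIntegral.integral_interval_sub_left
    (intervalIntegrable_comp_toNNReal hh 0 t) (intervalIntegrable_comp_toNNReal hh 0 s)]
  calc ‖∫ u in (s : ℝ)..t, h u.toNNReal‖
      ≤ ∫ u in (s : ℝ)..t, ‖h u.toNNReal‖ :=
        intervalIntegral.norm_integral_le_integral_norm (NNReal.coe_le_coe.mpr hst)
    _ ≤ ∫ u in (s : ℝ)..T, ‖h u.toNNReal‖ :=
        intervalIntegral.integral_mono_interval le_rfl (NNReal.coe_le_coe.mpr hst)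
          (NNReal.coe_le_coe.mpr htT) (ae_of_all _ fun _ => norm_nonneg _)
          (intervalIntegrable_comp_toNNReal hh.norm s T)

lemma stronglyMeasurable_integral_comp_toNNReal {Ω : Type*} {m : MeasurableSpace Ω}
    {h : ℝ≥0 → Ω → F} (hh_cont : ∀ ω, Continuous fun t => h t ω) {a b : ℝ≥0} (hab : a ≤ b)
    (hh : ∀ t ≤ b, StronglyMeasurable (h t)) :
    StronglyMeasurable fun ω => ∫ u in (a : ℝ)..b, h u.toNNReal ω := by
  have hjoint : StronglyMeasurable
      (Function.uncurry fun (u : ℝ) (ω : Ω) => h (min u.toNNReal b) ω) :=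
    stronglyMeasurable_uncurry_of_continuous_of_stronglyMeasurable
      (fun ω => (hh_cont ω).comp (continuous_real_toNNReal.min continuous_const))
      (fun _ => hh _ (min_le_right _ _))
  have hmin : ∀ ω, ∫ u in (a : ℝ)..b, h u.toNNReal ω =
      ∫ u in Set.Ioc (a : ℝ) b, h (min u.toNNReal b) ω := fun ω => by
    rw [intervalIntegral.integral_of_le (NNReal.coe_le_coe.mpr hab)]
    refine setIntegral_congr_fun measurableSet_Ioc fun u hu => ?_
    simp only [min_eq_left (Real.toNNReal_le_iff_le_coe.mpr hu.2)]
  simpa only [hmin] using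
    hjoint.integral_prod_left (μ := volume.restrict (Set.Ioc (a : ℝ) b))

end TimeIntegral

section IntegralAlong

variable {E F : Type*} [TopologicalSpace E] [NormedAddCommGroup F] [NormedSpace ℝ F]
  {s T : ℝ≥0} {f : E → F}

/-- The integral `∫ₛᵀ f(x(u)) du` of `f` along a path `x` on `[s, T]`. Paths live on an interval of
`ℝ≥0` while the integration variable is real, so `x` is extended by its end values. -/
noncomputable def integralAlong (hsT : s ≤ T) (f : E → F) (x : C(Set.Icc s T, E)) : F :=
  ∫ u in (s : ℝ)..T, f (Set.IccExtend hsT x u.toNNReal)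

lemma integralAlong_eq_of_eqOn (hsT : s ≤ T) {x : C(Set.Icc s T, E)} {y : ℝ → E}
    (hxy : ∀ t : Set.Icc s T, x t = y (t : ℝ≥0)) :
    integralAlong hsT f x = ∫ u in (s : ℝ)..T, f (y u) := by
  refine intervalIntegral.integral_congr fun u hu => ?_
  rw [Set.uIcc_of_le (NNReal.coe_le_coe.mpr hsT)] at hu
  have hu_mem : u.toNNReal ∈ Set.Icc s T :=
    ⟨NNReal.le_toNNReal_of_coe_le hu.1, Real.toNNReal_le_iff_le_coe.mpr hu.2⟩
  simp only [Set.IccExtend_of_mem _ _ hu_mem, hxy, Real.coe_toNNReal u (s.coe_nonneg.trans hu.1)]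

lemma continuous_integralAlong (hsT : s ≤ T) (hf : Continuous f) :
    Continuous (integralAlong hsT f) := by
  have hpost : Continuous fun x : C(Set.Icc s T, E) => ContinuousMap.comp ⟨f, hf⟩ x :=
    ContinuousMap.continuous_postcomp _
  have hint : Continuous fun y : C(Set.Icc s T, F) =>
      ∫ u in (s : ℝ)..T, y (Set.projIcc s T hsT u.toNNReal) := by
    refine intervalIntegral.continuous_parametric_intervalIntegral_of_continuous' ?_ _ _
    exact continuous_eval.comp (continuous_fst.prodMk
      (((continuous_projIcc (h := hsT)).comp continuous_real_toNNReal).comp continuous_snd))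
  exact hint.comp hpost

lemma integral_comp_path_extend_div {a z : E} (γ : Path a z) (hf : Continuous f) (hz : f z = 0)
    {s T δ : ℝ} (hδ : 0 < δ) (hδT : s + δ ≤ T) :
    ∫ u in s..T, f (γ.extend ((u - s) / δ)) = δ • ∫ v in (0 : ℝ)..1, f (γ.extend v) := by
  have hfγ : Continuous fun v => f (γ.extend v) := hf.comp γ.continuous_extend
  have hone : 1 ≤ (T - s) / δ := (one_le_div hδ).mpr (by linarith)
  have htail : ∫ v in (1 : ℝ)..((T - s) / δ), f (γ.extend v) = 0 := by
    rw [intervalIntegral.integral_congr (g := fun _ => 0), intervalIntegral.integral_zero]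
    intro v hv
    rw [Set.uIcc_of_le hone] at hv
    simp only [γ.extend_of_one_le hv.1, hz]
  calc ∫ u in s..T, f (γ.extend ((u - s) / δ))
      = δ • ∫ v in (0 : ℝ)..((T - s) / δ), f (γ.extend v) := by
        simp only [sub_div]
        rw [intervalIntegral.integral_comp_div_sub (fun v => f (γ.extend v)) hδ.ne']
        simp only [sub_self]
    _ = δ • ∫ v in (0 : ℝ)..1, f (γ.extend v) := by
        rw [← intervalIntegral.integral_add_adjacent_intervals (hfγ.intervalIntegrable 0 1)
          (hfγ.intervalIntegrable 1 _), htail, add_zero]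

lemma exists_norm_integralAlong_lt {a z : E} (haz : Joined a z) (hsT : s < T) (hf : Continuous f)
    (hz : f z = 0) {η : ℝ} (hη : 0 < η) :
    ∃ x : C(Set.Icc s T, E), x ⟨s, Set.left_mem_Icc.mpr hsT.le⟩ = a ∧
      ‖integralAlong hsT.le f x‖ < η := by
  obtain ⟨γ⟩ := haz
  have hlim : Filter.Tendsto (fun δ : ℝ => ‖δ • ∫ v in (0 : ℝ)..1, f (γ.extend v)‖)
      (nhdsWithin 0 (Set.Ioi 0)) (nhds 0) := by
    refine (Continuous.tendsto' ?_ _ _ ?_).mono_left nhdsWithin_le_nhds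
    · fun_prop
    · rw [zero_smul, norm_zero]
  obtain ⟨δ, hδη, hδ, hδT⟩ := ((hlim.eventually_lt_const hη).and
    (Ioc_mem_nhdsGT (sub_pos.mpr (NNReal.coe_lt_coe.mpr hsT)))).exists
  let x : C(Set.Icc s T, E) :=
    ⟨fun t => γ.extend (((t : ℝ≥0) - s : ℝ) / δ), γ.continuous_extend.comp (by fun_prop)⟩
  refine ⟨x, by simp [x], ?_⟩
  rwa [integralAlong_eq_of_eqOn hsT.le (y := fun u => γ.extend ((u - s) / δ)) fun _ => rfl,
    integral_comp_path_extend_div γ hf hz hδ (by linarith)]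

end IntegralAlong

section ConditionalFullSupport

variable {Ω E F : Type*} [TopologicalSpace E] [NormedAddCommGroup F] [NormedSpace ℝ F]
  {mΩ : MeasurableSpace Ω} {μ : Measure Ω} {ℱ : Filtration ℝ≥0 mΩ} {X : ℝ≥0 → Ω → E}
  {hX_cont : ∀ ω, Continuous fun t => X t ω} {s T : ℝ≥0} {f : E → F}

lemma integralAlong_pathOn (hsT : s ≤ T) (ω : Ω) :
    integralAlong hsT f (pathOn X hX_cont s T ω) = ∫ u in (s : ℝ)..T, f (X u.toNNReal ω) :=
  integralAlong_eq_of_eqOn hsT fun t => by rw [Real.toNNReal_coe]; rfl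

lemma HasConditionalFullSupport.ae_condProb_pos (h : HasConditionalFullSupport ℱ X hX_cont μ)
    (hsT : s < T) {O : Set C(Set.Icc s T, E)} (hO : IsOpen O)
    (hO_start : ∀ a, ∃ x ∈ O, x ⟨s, Set.left_mem_Icc.mpr hsT.le⟩ = a) :
    ∀ᵐ ω ∂μ, 0 < (μ⟦pathOn X hX_cont s T ⁻¹' O | ℱ s⟧) ω := by
  obtain ⟨κ, hκ, hκ_support⟩ := h s T hsT
  filter_upwards [hκ_support, hκ.condProb_eq O hO.measurableSet] with ω hω_support hω_eq
  have := hκ.isMarkovKernel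
  obtain ⟨x, hxO, hxs⟩ := hO_start (X s ω)
  have hx : x ∈ (κ ω).support := hω_support ▸ hxs
  rw [← hω_eq]
  exact ENNReal.toReal_pos ((Measure.mem_support_iff_forall x).mp hx O (hO.mem_nhds hxO)).ne'
    (measure_ne_top _ _)

lemma HasConditionalFullSupport.isStickyAtDeterministicTimes_integral [IsFiniteMeasure μ]
    (h : HasConditionalFullSupport ℱ X hX_cont μ) (hX : ∀ t, StronglyMeasurable (X t))
    (hf : Continuous f) (hf_zero : ∀ a, ∃ z, Joined a z ∧ f z = 0) :
    IsStickyAtDeterministicTimes ℱ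
      (fun (t : ℝ≥0) (ω : Ω) => ∫ u in (0 : ℝ)..t, f (X u.toNNReal ω)) μ := by
  intro s T hsT η hη
  have hfX_cont : ∀ ω, Continuous fun t => f (X t ω) := fun ω => hf.comp (hX_cont ω)
  have hfX : ∀ t, StronglyMeasurable fun ω => f (X t ω) := fun t =>
    hf.comp_stronglyMeasurable (hX t)
  have hU : ∀ t : ℝ≥0, StronglyMeasurable fun ω => ∫ u in (0 : ℝ)..t, f (X u.toNNReal ω) :=
    fun t => stronglyMeasurable_integral_comp_toNNReal hfX_cont zero_le fun u _ => hfX u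
  let O : Set C(Set.Icc s T, E) := {x | ‖integralAlong hsT.le (fun a => ‖f a‖) x‖ < η}
  have hO : IsOpen O := isOpen_lt (continuous_integralAlong hsT.le hf.norm).norm continuous_const
  have hO_start : ∀ a, ∃ x ∈ O, x ⟨s, Set.left_mem_Icc.mpr hsT.le⟩ = a := fun a => by
    obtain ⟨z, haz, hz⟩ := hf_zero a
    obtain ⟨x, hxs, hxη⟩ :=
      exists_norm_integralAlong_lt haz hsT hf.norm (norm_eq_zero.mpr hz) hη
    exact ⟨x, hxη, hxs⟩
  refine ae_condProb_pos_mono ?_ ?_ ?_ (h.ae_condProb_pos hsT hO hO_start)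
  · simp only [O, Set.preimage_ofPred_eq, integralAlong_pathOn]
    exact measurableSet_lt (stronglyMeasurable_integral_comp_toNNReal (fun ω => (hfX_cont ω).norm)
      hsT.le fun t _ => (hfX t).norm).norm.measurable measurable_const
  · simpa only [WithTop.coe_le_coe] using
      measurableSet_forall_dist_le (σ := fun _ => (s : WithTop ℝ≥0)) (ε := fun _ => η)
        (fun ω => continuous_integral_comp_toNNReal (hfX_cont ω)) (fun t _ => hU t)
        measurable_const (hU s) measurable_const
  · intro ω (hω : ‖integralAlong hsT.le (fun a => ‖f a‖) (pathOn X hX_cont s T ω)‖ < η) t hst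
    rw [integralAlong_pathOn] at hω
    exact (dist_integral_comp_toNNReal_le (hfX_cont ω) (le_min hst hsT.le) (min_le_right t T)).trans
      ((Real.le_norm_self _).trans hω.le)

end ConditionalFullSupport

theorem propositionP_general {Ω E F : Type*} [TopologicalSpace E] [NormedAddCommGroup F]
    [NormedSpace ℝ F] [CompleteSpace F] {mΩ : MeasurableSpace Ω} (μ : Measure Ω) [IsFiniteMeasure μ]
    (ℱ : Filtration ℝ≥0 mΩ) (X : ℝ≥0 → Ω → E) (hX_adapted : StronglyAdapted ℱ X)
    (hX_cont : ∀ ω, Continuous fun t => X t ω) (hX_cfs : HasConditionalFullSupport ℱ X hX_cont μ)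
    (f : E → F) (hf_cont : Continuous f) (hf_zero : ∀ x, ∃ z, Joined x z ∧ f z = 0) :
    IsSticky ℱ (fun (t : ℝ≥0) (ω : Ω) => ∫ s in (0 : ℝ)..t, f (X s.toNNReal ω)) μ := by
  have hfX_cont : ∀ ω, Continuous fun t => f (X t ω) := fun ω => hf_cont.comp (hX_cont ω)
  refine (hX_cfs.isStickyAtDeterministicTimes_integral (fun t => hX_adapted.stronglyMeasurable)
    hf_cont hf_zero).isSticky (fun t => ?_) fun ω => continuous_integral_comp_toNNReal (hfX_cont ω)
  exact stronglyMeasurable_integral_comp_toNNReal hfX_cont zero_le fun u hu =>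
    hf_cont.comp_stronglyMeasurable (hX_adapted.stronglyMeasurable_le hu)

theorem propositionP {Ω : Type*} {mΩ : MeasurableSpace Ω} (μ : Measure Ω) [IsProbabilityMeasure μ]
    (ℱ : Filtration ℝ≥0 mΩ) [ℱ.IsRightContinuous]
    (n : ℕ) (𝒳 : Set (EuclideanSpace ℝ (Fin n))) (h𝒳_open : IsOpen 𝒳) (h𝒳_conn : IsConnected 𝒳)
    (X : ℝ≥0 → Ω → 𝒳) (hX_adapted : Adapted ℱ X)
    (hX_cont : ∀ ω, Continuous fun t => X t ω)
    (hX_cfs : HasConditionalFullSupport ℱ X hX_cont μ)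
    (f : 𝒳 → ℝ) (hf_cont : Continuous f) (hf_nonneg : ∀ x, 0 ≤ f x) (hf_zero : ∃ x, f x = 0) :
    IsSticky ℱ (fun (t : ℝ≥0) (ω : Ω) => ∫ s in (0 : ℝ)..t, f (X s.toNNReal ω)) μ := by
  have : PathConnectedSpace 𝒳 :=
    isPathConnected_iff_pathConnectedSpace.mp (h𝒳_open.isConnected_iff_isPathConnected.mp h𝒳_conn)
  obtain ⟨z, hz⟩ := hf_zero
  exact propositionP_general μ ℱ X hX_adapted.stronglyAdapted hX_cont hX_cfs f hf_cont fun x =>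
    ⟨z, PathConnectedSpace.joined x z, hz⟩
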